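/- Let $u=(x^i,y^a)$, $i=1,2,3$, $a=4,5$, $y^4=v$, be coordinates on an open set $U\subset\mathbb R^5$. For a function $\omega$ on $U$ consider the metric $${}^{\omega}\mathbf g=\epsilon_1\,dx^1\otimes dx^1+\sum_{\hat\imath=2,3} g_{\hat\imath}(x^2,x^3)\,dx^{\hat\imath}\otimes dx^{\hat\imath}+\omega^2(x^i,y^a)\sum_{a=4,5}h_a(x^i,v)\,\mathbf e^a\otimes\mathbf e^a,$$ $$\mathbf e^4=dy^4+w_i(x^k,v)\,dx^i,\qquad \mathbf e^5=dy^5+n_i(x^k,v)\,dx^i,$$ where $\epsilon_1=\pm1$, all coefficients and $\omega$ are of class $C^2$, and $g_{\hat\imath},h_a,\omega$ vanish nowhere on $U$. Put $N^4_i=w_i$, $N^5_i=n_i$, $\mathbf e_i=\partial_i-N^a_i\partial_a$, $e_a=\partial_a$. For a metric $g_{ij}\,dx^i\otimes dx^j+h_{ab}\,\mathbf e^a\otimes\mathbf e^b$ the canonical d-connection $\widehat{\mathbf D}$ has, in the frame $(\mathbf e_i,e_a)$, the coefficients $$\widehat L^i_{jk}=\tfrac12 g^{ir}(\mathbf e_kg_{jr}+\mathbf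 e_jg_{kr}-\mathbf e_rg_{jk}),\quad \widehat L^a_{bk}=e_bN^a_k+\tfrac12h^{ac}(\mathbf e_kh_{bc}-h_{dc}e_bN^d_k-h_{db}e_cN^d_k),$$ $$\widehat C^i_{jc}=\tfrac12g^{ik}e_cg_{jk},\quad \widehat C^a_{bc}=\tfrac12h^{ad}(e_ch_{bd}+e_bh_{cd}-e_dh_{bc}),$$ i.e. $\widehat{\mathbf D}_{\mathbf e_k}\mathbf e_j=\widehat L^i_{jk}\mathbf e_i$, $\widehat{\mathbf D}_{\mathbf e_k}e_b=\widehat L^a_{bk}e_a$, $\widehat{\mathbf D}_{e_c}\mathbf e_j=\widehat C^i_{jc}\mathbf e_i$, $\widehat{\mathbf D}_{e_c}e_b=\widehat C^a_{bc}e_a$. Let $\widehat T^c_{ja}=\widehat L^c_{aj}-e_aN^c_j$; let $\widehat R_{\alpha\beta}$ be the Ricci tensor of $\widehat{\mathbf D}$, that is, the contraction of $\tau$ in the $\mathbf e_\tau$-component of $\big(\widehat{\mathbf D}_{\mathbf e_\tau}\widehat{\mathbf D}_{\mathbf e_\beta}-\widehat{\mathbf D}_{\mathbf e_\beta}\widehat{\mathbf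 D}_{\mathbf e_\tau}-\widehat{\mathbf D}_{[\mathbf e_\tau,\mathbf e_\beta]}\big)\mathbf e_\alpha$; and let $\widehat E_{\alpha\beta}=\widehat R_{\alpha\beta}-\tfrac12\mathbf g_{\alpha\beta}\mathbf g^{\mu\nu}\widehat R_{\mu\nu}$ be its Einstein tensor. Objects without the label $\omega$ belong to the metric with $\omega=1$, which is invariant under $\partial/\partial y^5$; those labelled by $\omega$ belong to ${}^\omega\mathbf g$. Suppose that the metric with $\omega=1$ satisfies $\widehat R^{\alpha}{}_{\beta}=\Upsilon^{\alpha}{}_{\beta}$ on $U$ for some diagonal source $\Upsilon^\alpha{}_\beta=\mathrm{diag}[\Upsilon_\gamma(u)]$, that $\widehat T^c_{ja}=0$, and that $\mathbf e_k\omega=0$ for $k=1,2,3$. Then on $U$ $${}^{\omega}\widehat R^{a}{}_{b}=\widehat R^{a}{}_{b}+{}^{\omega}\widehat Z\,\delta^a_b,\qquad {}^{\omega}\widehat R_{ai}=\widehat R_{ai}=0,\qquad {}^{\omega}\widehat R_{ij}=\widehat R_{ij},\qquad {}^{\omega}\widehat R_{ia}=\widehat R_{ia},$$ where ${}^\omega\widehat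 Z$ is the two-dimensional conformal term $${}^{\omega}\widehat Z=\omega^{-2}\big(K-\Delta_h\ln|\omega|\big)-K,\qquad K=\tfrac12h^{ab}\widehat R_{ab},\qquad \Delta_hf=h^{ab}(e_ae_bf-\widehat C^c_{ab}e_cf),$$ with $h_{ab}=\mathrm{diag}[h_4,h_5]$. Consequently the field equations hold for ${}^\omega\mathbf g$ with a redefined source: ${}^\omega\widehat R^\alpha{}_\beta=\mathrm{diag}[\Upsilon_1,\Upsilon_2,\Upsilon_3,\Upsilon_4+{}^\omega\widehat Z,\Upsilon_5+{}^\omega\widehat Z]$. Moreover, whenever $\widehat E^\alpha{}_\beta=\mathrm{diag}[S_2+S_4,S_2,S_2,S_4,S_4]$ on $U$ for functions $S_2,S_4$, the same equation holds for ${}^\omega\widehat E^\alpha{}_\beta$ with $S_2$ replaced by $S_2-{}^\omega\widehat Z$. -/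

import Mathlib

/-- Coordinates `u = (x, y)` with `x = (x¹, x², x³)` (indices `0, 1, 2`) and
`y = (y⁴, y⁵) = (v, y)` (indices `0, 1`). -/
abbrev Coord : Type := (Fin 3 → ℝ) × (Fin 2 → ℝ)

/-- Frame indices: horizontal `i = 1, 2, 3` and vertical `a = 4, 5`. -/
abbrev Idx : Type := Fin 3 ⊕ Fin 2

/-- The partial derivative `∂_i = ∂/∂xⁱ`. -/
noncomputable def dx (i : Fin 3) (f : Coord → ℝ) (u : Coord) : ℝ :=
  fderiv ℝ f u (Pi.single i 1, 0)

/-- The partial derivative `e_a = ∂_a = ∂/∂yᵃ`. -/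
noncomputable def dy (a : Fin 2) (f : Coord → ℝ) (u : Coord) : ℝ :=
  fderiv ℝ f u (0, Pi.single a 1)

/-- A metric `g_ij eⁱ ⊗ eʲ + h_ab eᵃ ⊗ eᵇ` in N-adapted form, where `eⁱ = dxⁱ` and
`eᵃ = dyᵃ + N_iᵃ dxⁱ`; here `N u a i` is `N_iᵃ(u)`. -/
structure DMetric where
  g : Coord → Matrix (Fin 3) (Fin 3) ℝ
  h : Coord → Matrix (Fin 2) (Fin 2) ℝ
  N : Coord → Matrix (Fin 2) (Fin 3) ℝ

namespace DMetric

/-- The horizontal frame vectors `e_i = ∂_i - N_iᵃ ∂_a`, acting on functions. -/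
noncomputable def eh (M : DMetric) (i : Fin 3) (f : Coord → ℝ) (u : Coord) : ℝ :=
  dx i f u - ∑ a, M.N u a i * dy a f u

/-- The N-adapted frame `e_α = (e_i, ∂_a)`, acting on functions. -/
noncomputable def e (M : DMetric) : Idx → (Coord → ℝ) → Coord → ℝ
  | .inl i => M.eh i
  | .inr a => dy a

/-- Horizontal coefficients `Lⁱ_jk` of the canonical d-connection. -/
noncomputable def Lh (M : DMetric) (i j k : Fin 3) (u : Coord) : ℝ :=
  (1 / 2) * ∑ r, (M.g u)⁻¹ i r *
    (M.eh k (fun p => M.g p j r) u + M.eh j (fun p => M.g p k r) u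
      - M.eh r (fun p => M.g p j k) u)

/-- Coefficients `Lᵃ_bk` of the canonical d-connection. -/
noncomputable def Lv (M : DMetric) (a b : Fin 2) (k : Fin 3) (u : Coord) : ℝ :=
  dy b (fun p => M.N p a k) u + (1 / 2) * ∑ c, (M.h u)⁻¹ a c *
    (M.eh k (fun p => M.h p b c) u
      - ∑ d, M.h u d c * dy b (fun p => M.N p d k) u
      - ∑ d, M.h u d b * dy c (fun p => M.N p d k) u)

/-- Coefficients `Cⁱ_jc` of the canonical d-connection. -/
noncomputable def Ch (M : DMetric) (i j : Fin 3) (c : Fin 2) (u : Coord) : ℝ :=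
  (1 / 2) * ∑ k, (M.g u)⁻¹ i k * dy c (fun p => M.g p j k) u

/-- Vertical coefficients `Cᵃ_bc` of the canonical d-connection. -/
noncomputable def Cv (M : DMetric) (a b c : Fin 2) (u : Coord) : ℝ :=
  (1 / 2) * ∑ d, (M.h u)⁻¹ a d *
    (dy c (fun p => M.h p b d) u + dy b (fun p => M.h p c d) u
      - dy d (fun p => M.h p b c) u)

/-- All coefficients `Γ^α_βγ` of the canonical d-connection in the N-adapted frame,
`D_{e_γ} e_β = Γ^α_βγ e_α`; those mixing the horizontal and vertical parts vanish. -/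
noncomputable def Gam (M : DMetric) : Idx → Idx → Idx → Coord → ℝ
  | .inl i, .inl j, .inl k => M.Lh i j k
  | .inr a, .inr b, .inl k => M.Lv a b k
  | .inl i, .inl j, .inr c => M.Ch i j c
  | .inr a, .inr b, .inr c => M.Cv a b c
  | .inl _, .inr _, _ => fun _ => 0
  | .inr _, .inl _, _ => fun _ => 0

/-- Anholonomy coefficients: `[e_α, e_β] = W^γ_αβ e_γ`, written `anh γ α β`. The nonzero ones are
`[e_i, e_j] = (e_j N_iᵃ - e_i N_jᵃ) ∂_a` and `[e_i, ∂_b] = (∂_b N_iᵃ) ∂_a = -[∂_b, e_i]`. -/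
noncomputable def anh (M : DMetric) : Idx → Idx → Idx → Coord → ℝ
  | .inr a, .inl i, .inl j => fun u =>
      M.eh j (fun p => M.N p a i) u - M.eh i (fun p => M.N p a j) u
  | .inr a, .inl i, .inr b => fun u => dy b (fun p => M.N p a i) u
  | .inr a, .inr b, .inl i => fun u => - dy b (fun p => M.N p a i) u
  | .inr _, .inr _, .inr _ => fun _ => 0
  | .inl _, _, _ => fun _ => 0

/-- The torsion coefficients `Tᶜ_ja = Lᶜ_aj - ∂_a N_jᶜ` of the canonical d-connection. -/
noncomputable def torV (M : DMetric) (c : Fin 2) (j : Fin 3) (a : Fin 2) (u : Coord) : ℝ :=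
  M.Lv c a j u - dy a (fun p => M.N p c j) u

/-- Curvature coefficients `R^α_βγδ`: the `e_α`-component of
`(D_δ D_γ - D_γ D_δ - D_{[e_δ, e_γ]}) e_β`. -/
noncomputable def riem (M : DMetric) (α β γ δ : Idx) (u : Coord) : ℝ :=
  M.e δ (M.Gam α β γ) u - M.e γ (M.Gam α β δ) u
    + ∑ τ, (M.Gam τ β γ u * M.Gam α τ δ u - M.Gam τ β δ u * M.Gam α τ γ u)
    - ∑ τ, M.anh τ δ γ u * M.Gam α β τ u

/-- The Ricci tensor `R_αβ = R^τ_αβτ` of the canonical d-connection. -/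
noncomputable def ric (M : DMetric) (α β : Idx) (u : Coord) : ℝ :=
  ∑ τ, M.riem τ α β τ u

/-- The matrix of the metric in the N-adapted frame. -/
def met (M : DMetric) (u : Coord) : Matrix Idx Idx ℝ :=
  Matrix.fromBlocks (M.g u) 0 0 (M.h u)

/-- The matrix of the inverse metric in the N-adapted frame. -/
noncomputable def metInv (M : DMetric) (u : Coord) : Matrix Idx Idx ℝ :=
  Matrix.fromBlocks (M.g u)⁻¹ 0 0 (M.h u)⁻¹

/-- Mixed Ricci components `R^α_β = g^{ατ} R_τβ`. -/
noncomputable def ricMixed (M : DMetric) (α β : Idx) (u : Coord) : ℝ :=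
  ∑ τ, M.metInv u α τ * M.ric τ β u

/-- The scalar curvature `g^{αβ} R_αβ` of the canonical d-connection. -/
noncomputable def scal (M : DMetric) (u : Coord) : ℝ :=
  ∑ α, ∑ β, M.metInv u α β * M.ric α β u

/-- The Einstein tensor `E_αβ = R_αβ - (1/2) g_αβ R` of the canonical d-connection. -/
noncomputable def ein (M : DMetric) (α β : Idx) (u : Coord) : ℝ :=
  M.ric α β u - (1 / 2) * M.met u α β * M.scal u

/-- Mixed components `E^α_β = g^{ατ} E_τβ`. -/
noncomputable def einMixed (M : DMetric) (α β : Idx) (u : Coord) : ℝ :=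
  ∑ τ, M.metInv u α τ * M.ein τ β u

/-- The Gauss curvature `(1/2) h^{ab} R_ab` of the two-dimensional vertical metric. -/
noncomputable def vGauss (M : DMetric) (u : Coord) : ℝ :=
  (1 / 2) * ∑ a, ∑ b, (M.h u)⁻¹ a b * M.ric (.inr a) (.inr b) u

/-- The Laplacian `h^{ab} (∂_a ∂_b f - Cᶜ_ab ∂_c f)` of the vertical metric. -/
noncomputable def vLap (M : DMetric) (f : Coord → ℝ) (u : Coord) : ℝ :=
  ∑ a, ∑ b, (M.h u)⁻¹ a b * (dy a (dy b f) u - ∑ c, M.Cv c a b u * dy c f u)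

/-- The change `K(ω² h) - K(h)` of the Gauss curvature of the vertical metric `h` under the
two-dimensional conformal transform with factor `ω²`:
`ω⁻² (K - Δ log |ω|) - K` (`Real.log` is the logarithm of the absolute value). -/
noncomputable def confTerm (M : DMetric) (ω : Coord → ℝ) (u : Coord) : ℝ :=
  (ω u ^ 2)⁻¹ * (M.vGauss u - M.vLap (fun p => Real.log (ω p)) u) - M.vGauss u

end DMetric

/-- Coefficients `ε₁, g₂, g₃, h₄, h₅, w_i, n_i` of the ansatz, each with the variables it may
depend on: `g₂, g₃` on `(x², x³)`, all others on `(x, v)`. -/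
structure Ansatz where
  ε₁ : ℝ
  g₂ : ℝ → ℝ → ℝ
  g₃ : ℝ → ℝ → ℝ
  h₄ : (Fin 3 → ℝ) → ℝ → ℝ
  h₅ : (Fin 3 → ℝ) → ℝ → ℝ
  w : Fin 3 → (Fin 3 → ℝ) → ℝ → ℝ
  n : Fin 3 → (Fin 3 → ℝ) → ℝ → ℝ

namespace Ansatz

/-- The metric `ε₁ dx¹ ⊗ dx¹ + g₂ dx² ⊗ dx² + g₃ dx³ ⊗ dx³ + ω² h₄ e⁴ ⊗ e⁴ + ω² h₅ e⁵ ⊗ e⁵` with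
`e⁴ = dv + w_i dxⁱ`, `e⁵ = dy⁵ + n_i dxⁱ`. -/
noncomputable def toDMetric (A : Ansatz) (ω : Coord → ℝ) : DMetric where
  g := fun u => Matrix.diagonal ![A.ε₁, A.g₂ (u.1 1) (u.1 2), A.g₃ (u.1 1) (u.1 2)]
  h := fun u => Matrix.diagonal
    ![ω u ^ 2 * A.h₄ u.1 (u.2 0), ω u ^ 2 * A.h₅ u.1 (u.2 0)]
  N := fun u => Matrix.of
    ![fun i => A.w i u.1 (u.2 0), fun i => A.n i u.1 (u.2 0)]

/-- The coefficients are twice continuously differentiable on `U` and the metric is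
nondegenerate there (of arbitrary signature), with `ε₁ = ±1`. -/
structure RegularOn (A : Ansatz) (U : Set Coord) : Prop where
  eps : A.ε₁ = 1 ∨ A.ε₁ = -1
  g₂_smooth : ContDiffOn ℝ 2 (fun u : Coord => A.g₂ (u.1 1) (u.1 2)) U
  g₃_smooth : ContDiffOn ℝ 2 (fun u : Coord => A.g₃ (u.1 1) (u.1 2)) U
  h₄_smooth : ContDiffOn ℝ 2 (fun u : Coord => A.h₄ u.1 (u.2 0)) U
  h₅_smooth : ContDiffOn ℝ 2 (fun u : Coord => A.h₅ u.1 (u.2 0)) U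
  w_smooth : ∀ i, ContDiffOn ℝ 2 (fun u : Coord => A.w i u.1 (u.2 0)) U
  n_smooth : ∀ i, ContDiffOn ℝ 2 (fun u : Coord => A.n i u.1 (u.2 0)) U
  g₂_ne : ∀ u ∈ U, A.g₂ (u.1 1) (u.1 2) ≠ 0
  g₃_ne : ∀ u ∈ U, A.g₃ (u.1 1) (u.1 2) ≠ 0
  h₄_ne : ∀ u ∈ U, A.h₄ u.1 (u.2 0) ≠ 0
  h₅_ne : ∀ u ∈ U, A.h₅ u.1 (u.2 0) ≠ 0

end Ansatz

/-- The diagonal source `diag[S_γ]`. -/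
def diagSource (S : Idx → Coord → ℝ) (α β : Idx) (u : Coord) : ℝ :=
  if α = β then S α u else 0

/-- The diagonal entries `(S₂ + S₄, S₂, S₂, S₄, S₄)`. -/
def sourceEntries (S₂ S₄ : Coord → ℝ) : Idx → Coord → ℝ
  | .inl i => fun u => if i = 0 then S₂ u + S₄ u else S₂ u
  | .inr _ => S₄

/-!
Replacing the vertical metric `h` by `ω² h` keeps the horizontal metric and the N-connection, and
the rows `R_iβ` of the Ricci tensor only involve these.

The block `R_ab` is the Ricci tensor of the Levi-Civita connection of `h` in the two vertical
variables. Lowering an index makes its curvature skew, so in dimension two `R_ab = K h_ab`, whence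
`R^a_b = K δ^a_b`. The conformal change of the connection gives `K' = ω⁻² (K - Δ log |ω|)`, so
`R^a_b` changes by `Z δ^a_b` with `Z = K' - K`.

If `Tᶜ_ja = 0` then `Lᶜ_aj = ∂_a N_jᶜ`, and `e_j ω = 0` preserves this for `ω² h`. Then `R_ai`
depends on `h` only through `-e_i C_a + (∂_a N_iᵇ) C_b`, where `C_a = Cᵇ_ab` grows by
`2 ∂_a log |ω|`. Since `e_i log |ω| = 0`, the change of this expression is
`-2 (e_i ∂_a - [e_i, ∂_a]) log |ω| = -2 ∂_a e_i log |ω| = 0`.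

Finally the scalar curvature grows by `2 Z`, so that `E^i_j` drops by `Z δ^i_j` and `E^a_b` is
unchanged.
-/

open Filter Topology

section SecondDerivative

variable {E F : Type*} [NormedAddCommGroup E] [NormedSpace ℝ E] [NormedAddCommGroup F]
  [NormedSpace ℝ F] {f : E → F} {x : E}

theorem differentiableAt_fderiv_apply (hf : ContDiffAt ℝ 2 f x) (v : E) :
    DifferentiableAt ℝ (fun p => fderiv ℝ f p v) x :=
  ((hf.fderiv_right (m := 1) (by norm_num)).differentiableAt (by norm_num)).clm_apply
    (differentiableAt_const v)

theorem fderiv_fderiv_apply_comm (hf : ContDiffAt ℝ 2 f x) (v w : E) :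
    fderiv ℝ (fun p => fderiv ℝ f p v) x w = fderiv ℝ (fun p => fderiv ℝ f p w) x v := by
  have hd := (hf.fderiv_right (m := 1) (by norm_num)).differentiableAt (by norm_num)
  rw [fderiv_clm_apply hd (differentiableAt_const v),
    fderiv_clm_apply hd (differentiableAt_const w)]
  simpa using (hf.isSymmSndFDerivAt (by simp)).eq w v

end SecondDerivative

section DirectionalDerivative

variable {ι : Type*} [Fintype ι] {f g : Coord → ℝ} {F G : ι → Coord → ℝ} {u : Coord}

theorem dy_congr (h : f =ᶠ[𝓝 u] g) (a : Fin 2) : dy a f u = dy a g u := by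
  simp only [dy, h.fderiv_eq]

theorem dy_add (hf : DifferentiableAt ℝ f u) (hg : DifferentiableAt ℝ g u) (a : Fin 2) :
    dy a (fun p => f p + g p) u = dy a f u + dy a g u := by
  simp only [dy, fderiv_fun_add hf hg, add_apply]

theorem dy_sub (hf : DifferentiableAt ℝ f u) (hg : DifferentiableAt ℝ g u) (a : Fin 2) :
    dy a (fun p => f p - g p) u = dy a f u - dy a g u := by
  simp only [dy, fderiv_fun_sub hf hg, sub_apply]

theorem dy_const_mul (c : ℝ) (hf : DifferentiableAt ℝ f u) (a : Fin 2) :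
    dy a (fun p => c * f p) u = c * dy a f u := by
  simp only [dy, fderiv_const_mul hf, smul_apply, smul_eq_mul]

theorem dy_mul (hf : DifferentiableAt ℝ f u) (hg : DifferentiableAt ℝ g u) (a : Fin 2) :
    dy a (fun p => f p * g p) u = dy a f u * g u + f u * dy a g u := by
  simp only [dy, fderiv_fun_mul hf hg, add_apply, smul_apply, smul_eq_mul]
  ring

theorem dy_sum_mul (hF : ∀ i, DifferentiableAt ℝ (F i) u) (hG : ∀ i, DifferentiableAt ℝ (G i) u)
    (a : Fin 2) :
    dy a (fun p => ∑ i, F i p * G i p) u = ∑ i, (dy a (F i) u * G i u + F i u * dy a (G i) u) := by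
  rw [← Finset.sum_congr rfl fun i _ => dy_mul (hF i) (hG i) a]
  simp only [dy, fderiv_fun_sum fun i _ => (hF i).fun_mul (hG i), sum_apply]

theorem dy_log (hf : DifferentiableAt ℝ f u) (hf0 : f u ≠ 0) (a : Fin 2) :
    dy a (fun p => Real.log (f p)) u = (f u)⁻¹ * dy a f u := by
  simp only [dy, fderiv.log hf hf0, smul_apply, smul_eq_mul]

theorem differentiableAt_dy (hf : ContDiffAt ℝ 2 f u) (a : Fin 2) :
    DifferentiableAt ℝ (dy a f) u :=
  differentiableAt_fderiv_apply hf _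

theorem dy_dy_comm (hf : ContDiffAt ℝ 2 f u) (a b : Fin 2) :
    dy a (dy b f) u = dy b (dy a f) u :=
  fderiv_fderiv_apply_comm hf _ _

theorem dx_dy_comm (hf : ContDiffAt ℝ 2 f u) (i : Fin 3) (a : Fin 2) :
    dx i (dy a f) u = dy a (dx i f) u :=
  fderiv_fderiv_apply_comm hf _ _

end DirectionalDerivative

namespace DMetric

variable {M : DMetric} {f g ω : Coord → ℝ} {u : Coord}

theorem eh_eq_fderiv (M : DMetric) (i : Fin 3) (f : Coord → ℝ) (u : Coord) :
    M.eh i f u = fderiv ℝ f u (Pi.single i 1, fun a => -M.N u a i) := by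
  have hframe : ((Pi.single i 1, fun a => -M.N u a i) : Coord)
      = (Pi.single i 1, 0) - ∑ a, M.N u a i • (0, Pi.single a 1) := by
    ext j
    · simp
    · fin_cases j <;> simp
  rw [hframe, map_sub, map_sum]
  simp only [eh, dx, dy, map_smul, smul_eq_mul]

theorem eh_congr (h : f =ᶠ[𝓝 u] g) (i : Fin 3) : M.eh i f u = M.eh i g u := by
  simp only [eh_eq_fderiv, h.fderiv_eq]

theorem eh_add (hf : DifferentiableAt ℝ f u) (hg : DifferentiableAt ℝ g u) (i : Fin 3) :
    M.eh i (fun p => f p + g p) u = M.eh i f u + M.eh i g u := by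
  simp only [eh_eq_fderiv, fderiv_fun_add hf hg, add_apply]

theorem eh_mul (hf : DifferentiableAt ℝ f u) (hg : DifferentiableAt ℝ g u) (i : Fin 3) :
    M.eh i (fun p => f p * g p) u = M.eh i f u * g u + f u * M.eh i g u := by
  simp only [eh_eq_fderiv, fderiv_fun_mul hf hg, add_apply, smul_apply, smul_eq_mul]
  ring

theorem eh_sq_mul {i : Fin 3} (hg : DifferentiableAt ℝ g u) (hf : DifferentiableAt ℝ f u)
    (hg0 : M.eh i g u = 0) : M.eh i (fun p => g p ^ 2 * f p) u = g u ^ 2 * M.eh i f u := by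
  simp only [pow_two]
  rw [eh_mul (hg.fun_mul hg) hf, eh_mul hg hg, hg0]
  ring

theorem eh_const (M : DMetric) (i : Fin 3) (c : ℝ) (u : Coord) : M.eh i (fun _ => c) u = 0 := by
  simp only [eh_eq_fderiv, fderiv_fun_const, Pi.zero_apply, zero_apply]

theorem eh_log (hf : DifferentiableAt ℝ f u) (hf0 : f u ≠ 0) (i : Fin 3) :
    M.eh i (fun p => Real.log (f p)) u = (f u)⁻¹ * M.eh i f u := by
  simp only [eh_eq_fderiv, fderiv.log hf hf0, smul_apply, smul_eq_mul]

theorem eh_dy_comm {i : Fin 3} (hf : ContDiffAt ℝ 2 f u)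
    (hN : ∀ b, DifferentiableAt ℝ (fun p => M.N p b i) u) (a : Fin 2) :
    M.eh i (dy a f) u = dy a (M.eh i f) u + ∑ b, dy a (fun p => M.N p b i) u * dy b f u := by
  have hd := differentiableAt_dy hf
  have hdy : dy a (M.eh i f) u = dy a (dx i f) u
      - ∑ b, (dy a (fun p => M.N p b i) u * dy b f u + M.N u b i * dy a (dy b f) u) := by
    rw [← dy_sum_mul hN hd]
    exact dy_sub (differentiableAt_fderiv_apply hf _)
      (.fun_sum fun b _ => (hN b).fun_mul (hd b)) a
  rw [hdy, Finset.sum_add_distrib, eh, dx_dy_comm hf]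
  simp only [dy_dy_comm hf a]
  ring

/-- Near `u` the vertical part `h` of the metric is a field of symmetric matrices, twice
continuously differentiable and nondegenerate at `u`. -/
structure VerticallyRegularAt (M : DMetric) (u : Coord) : Prop where
  isSymm : ∀ᶠ p in 𝓝 u, (M.h p).IsSymm
  isUnit_det : IsUnit (M.h u).det
  contDiffAt : ∀ a b, ContDiffAt ℝ 2 (fun p => M.h p a b) u

/-- The vertical gradient `h^{ab} ∂_b f` of a function. -/
noncomputable def vGrad (M : DMetric) (f : Coord → ℝ) (a : Fin 2) (u : Coord) : ℝ :=
  ∑ b, (M.h u)⁻¹ a b * dy b f u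

/-- The contraction `C_a = Cᵇ_ab` of the vertical connection coefficients. -/
noncomputable def CvTrace (M : DMetric) (a : Fin 2) (u : Coord) : ℝ :=
  ∑ b, M.Cv b a b u

namespace VerticallyRegularAt

theorem h_comm (hM : M.VerticallyRegularAt u) (a b : Fin 2) : M.h u a b = M.h u b a :=
  hM.isSymm.self_of_nhds.apply b a

theorem dy_h_comm (hM : M.VerticallyRegularAt u) (a b c : Fin 2) :
    dy c (fun p => M.h p a b) u = dy c (fun p => M.h p b a) u :=
  dy_congr (hM.isSymm.mono fun _ hp => hp.apply b a) c

theorem differentiableAt_h (hM : M.VerticallyRegularAt u) (a b : Fin 2) :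
    DifferentiableAt ℝ (fun p => M.h p a b) u :=
  (hM.contDiffAt a b).differentiableAt two_ne_zero

theorem differentiableAt_det (hM : M.VerticallyRegularAt u) :
    DifferentiableAt ℝ (fun p => (M.h p).det) u := by
  simp only [Matrix.det_fin_two]
  exact ((hM.differentiableAt_h 0 0).fun_mul (hM.differentiableAt_h 1 1)).fun_sub
    ((hM.differentiableAt_h 0 1).fun_mul (hM.differentiableAt_h 1 0))

theorem eventually (hM : M.VerticallyRegularAt u) : ∀ᶠ p in 𝓝 u, M.VerticallyRegularAt p := by
  have hdet := hM.differentiableAt_det.continuousAt.eventually_ne hM.isUnit_det.ne_zero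
  have hsmooth : ∀ᶠ p in 𝓝 u, ∀ a b, ContDiffAt ℝ 2 (fun q => M.h q a b) p := by
    simp only [eventually_all]
    exact fun a b => (hM.contDiffAt a b).eventually (by simp)
  filter_upwards [hM.isSymm.eventually_nhds, hdet, hsmooth] with p hp hp0 hp2
  exact ⟨hp, hp0.isUnit, hp2⟩

theorem sum_inv_mul_h (hM : M.VerticallyRegularAt u) (a b : Fin 2) :
    ∑ c, (M.h u)⁻¹ a c * M.h u c b = (1 : Matrix (Fin 2) (Fin 2) ℝ) a b := by
  rw [← Matrix.mul_apply, Matrix.nonsing_inv_mul _ hM.isUnit_det]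

theorem sum_sum_inv_mul_h (hM : M.VerticallyRegularAt u) :
    ∑ a, ∑ b, (M.h u)⁻¹ a b * M.h u a b = 2 := by
  calc ∑ a, ∑ b, (M.h u)⁻¹ a b * M.h u a b
    _ = ∑ a, ∑ b, (M.h u)⁻¹ a b * M.h u b a := by
      exact Finset.sum_congr rfl fun a _ => Finset.sum_congr rfl fun b _ => by rw [hM.h_comm a b]
    _ = 2 := by simp [hM.sum_inv_mul_h]

theorem sum_h_mul_sum_inv_mul (hM : M.VerticallyRegularAt u) (x : Fin 2 → ℝ) (a : Fin 2) :
    ∑ c, M.h u a c * ∑ b, (M.h u)⁻¹ c b * x b = x a := by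
  have h := congrFun (Matrix.mulVec_mulVec x (M.h u) (M.h u)⁻¹) a
  rwa [Matrix.mul_nonsing_inv _ hM.isUnit_det, Matrix.one_mulVec] at h

theorem sum_inv_mul_sum_h_mul (hM : M.VerticallyRegularAt u) (x : Fin 2 → ℝ) (a : Fin 2) :
    ∑ b, (M.h u)⁻¹ a b * ∑ c, M.h u b c * x c = x a := by
  have h := congrFun (Matrix.mulVec_mulVec x (M.h u)⁻¹ (M.h u)) a
  rwa [Matrix.nonsing_inv_mul _ hM.isUnit_det, Matrix.one_mulVec] at h

theorem differentiableAt_inv_h (hM : M.VerticallyRegularAt u) (a b : Fin 2) :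
    DifferentiableAt ℝ (fun p => (M.h p)⁻¹ a b) u := by
  have hadj : DifferentiableAt ℝ (fun p => (M.h p).adjugate a b) u := by
    simp only [Matrix.adjugate_fin_two]
    fin_cases a <;> fin_cases b
    exacts [hM.differentiableAt_h 1 1, (hM.differentiableAt_h 0 1).fun_neg,
      (hM.differentiableAt_h 1 0).fun_neg, hM.differentiableAt_h 0 0]
  simp only [Matrix.inv_def, Ring.inverse_eq_inv', Matrix.smul_apply, smul_eq_mul]
  exact (hM.differentiableAt_det.fun_inv hM.isUnit_det.ne_zero).fun_mul hadj

theorem differentiableAt_Cv (hM : M.VerticallyRegularAt u) (a b c : Fin 2) :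
    DifferentiableAt ℝ (M.Cv a b c) u := by
  have hdy (d e f : Fin 2) := differentiableAt_dy (hM.contDiffAt d e) f
  exact (DifferentiableAt.fun_sum fun d _ => (hM.differentiableAt_inv_h a d).fun_mul
    (((hdy b d c).fun_add (hdy c d b)).fun_sub (hdy b c d))).const_mul _

theorem differentiableAt_CvTrace (hM : M.VerticallyRegularAt u) (a : Fin 2) :
    DifferentiableAt ℝ (M.CvTrace a) u :=
  .fun_sum fun b _ => hM.differentiableAt_Cv b a b

theorem differentiableAt_vGrad (hM : M.VerticallyRegularAt u) (hf : ContDiffAt ℝ 2 f u)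
    (a : Fin 2) : DifferentiableAt ℝ (M.vGrad f a) u :=
  .fun_sum fun b _ => (hM.differentiableAt_inv_h a b).fun_mul (differentiableAt_dy hf b)

theorem Cv_comm (hM : M.VerticallyRegularAt u) (a b c : Fin 2) : M.Cv a b c u = M.Cv a c b u := by
  simp only [Cv, hM.dy_h_comm b c, add_comm (dy c _ u)]

theorem sum_h_mul_Cv (hM : M.VerticallyRegularAt u) (a b c : Fin 2) :
    ∑ d, M.h u a d * M.Cv d b c u = (1 / 2) * (dy c (fun p => M.h p b a) u
      + dy b (fun p => M.h p c a) u - dy a (fun p => M.h p b c) u) := by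
  simp only [Cv, mul_left_comm (M.h u a _), ← Finset.mul_sum]
  rw [hM.sum_h_mul_sum_inv_mul fun a => dy c (fun p => M.h p b a) u
    + dy b (fun p => M.h p c a) u - dy a (fun p => M.h p b c) u]

/- Metric compatibility `D_c h_ab = 0` of the vertical connection. -/
theorem dy_h (hM : M.VerticallyRegularAt u) (a b c : Fin 2) :
    dy c (fun p => M.h p a b) u =
      ∑ d, M.h u a d * M.Cv d b c u + ∑ d, M.h u b d * M.Cv d a c u := by
  rw [hM.sum_h_mul_Cv, hM.sum_h_mul_Cv, hM.dy_h_comm b a, hM.dy_h_comm c a, hM.dy_h_comm c b]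
  ring

theorem sum_h_mul_vGrad (hM : M.VerticallyRegularAt u) (f : Coord → ℝ) (a : Fin 2) :
    ∑ b, M.h u a b * M.vGrad f b u = dy a f u :=
  hM.sum_h_mul_sum_inv_mul (fun b => dy b f u) a

theorem dy_dy_eq_sum_vGrad (hM : M.VerticallyRegularAt u) (hf : ContDiffAt ℝ 2 f u)
    (a b : Fin 2) :
    dy a (dy b f) u = ∑ c, (dy a (fun p => M.h p b c) u * M.vGrad f c u
      + M.h u b c * dy a (M.vGrad f c) u) := by
  rw [← dy_sum_mul (hM.differentiableAt_h b) (hM.differentiableAt_vGrad hf)]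
  exact dy_congr (hM.eventually.mono fun p hp => (hp.sum_h_mul_vGrad f b).symm) a

theorem vLap_eq_divergence (hM : M.VerticallyRegularAt u) (hf : ContDiffAt ℝ 2 f u) :
    M.vLap f u = ∑ c, (dy c (M.vGrad f c) u + M.CvTrace c u * M.vGrad f c u) := by
  have hessian (a b : Fin 2) : dy a (dy b f) u - ∑ c, M.Cv c a b u * dy c f u
      = ∑ c, M.h u b c * (dy a (M.vGrad f c) u + ∑ d, M.Cv c d a u * M.vGrad f d u) := by
    simp only [hM.dy_dy_eq_sum_vGrad hf, hM.dy_h, ← hM.sum_h_mul_vGrad f, Fin.sum_univ_two,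
      hM.Cv_comm _ a b, hM.h_comm 1 0]
    ring
  simp only [vLap, hessian, hM.sum_inv_mul_sum_h_mul fun c =>
    dy _ (M.vGrad f c) u + ∑ d, M.Cv c d _ u * M.vGrad f d u]
  simp only [CvTrace, Finset.sum_add_distrib, Finset.sum_mul]
  rw [Finset.sum_comm (f := fun c d => M.Cv c d c u * M.vGrad f d u)]

end VerticallyRegularAt

theorem riem_vertical (M : DMetric) (a b c d : Fin 2) (u : Coord) :
    M.riem (.inr a) (.inr b) (.inr c) (.inr d) u =
      dy d (M.Cv a b c) u - dy c (M.Cv a b d) u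
        + ∑ e, (M.Cv e b c u * M.Cv a e d u - M.Cv e b d u * M.Cv a e c u) := by
  simp [riem, Gam, anh, e]

theorem riem_self (M : DMetric) (a b c : Fin 2) (u : Coord) :
    M.riem (.inr a) (.inr b) (.inr c) (.inr c) u = 0 := by
  simp [riem_vertical]

theorem riem_swap (M : DMetric) (a b c d : Fin 2) (u : Coord) :
    M.riem (.inr a) (.inr b) (.inr c) (.inr d) u =
      -M.riem (.inr a) (.inr b) (.inr d) (.inr c) u := by
  simp only [riem_vertical, Fin.sum_univ_two]
  ring

theorem ric_vertical (M : DMetric) (a b : Fin 2) (u : Coord) :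
    M.ric (.inr a) (.inr b) u = ∑ c, M.riem (.inr c) (.inr a) (.inr b) (.inr c) u := by
  simp [ric, riem, Gam, e, eh_const, dy]

namespace VerticallyRegularAt

/- Ricci identity for `h`: since `D h = 0`, lowering the first index of the curvature gives a form
that is skew in its first two indices. -/
theorem sum_h_mul_riem_skew (hM : M.VerticallyRegularAt u) (a b c d : Fin 2) :
    ∑ e, M.h u a e * M.riem (.inr e) (.inr b) (.inr c) (.inr d) u
      = -∑ e, M.h u b e * M.riem (.inr e) (.inr a) (.inr c) (.inr d) u := by
  have hdy (c d : Fin 2) : dy d (dy c fun p => M.h p a b) u =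
      ∑ e, (dy d (fun p => M.h p a e) u * M.Cv e b c u + M.h u a e * dy d (M.Cv e b c) u)
      + ∑ e, (dy d (fun p => M.h p b e) u * M.Cv e a c u + M.h u b e * dy d (M.Cv e a c) u) := by
    have hC (b : Fin 2) := fun e => hM.differentiableAt_Cv e b c
    have hsum (a b : Fin 2) : DifferentiableAt ℝ (fun p => ∑ e, M.h p a e * M.Cv e b c p) u :=
      .fun_sum fun e _ => (hM.differentiableAt_h a e).fun_mul (hC b e)
    rw [← dy_sum_mul (hM.differentiableAt_h a) (hC b),
      ← dy_sum_mul (hM.differentiableAt_h b) (hC a), ← dy_add (hsum a b) (hsum b a)]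
    exact dy_congr (hM.eventually.mono fun p hp => hp.dy_h a b c) d
  have hcomm := dy_dy_comm (hM.contDiffAt a b) c d
  rw [hdy, hdy] at hcomm
  simp only [hM.dy_h, Fin.sum_univ_two, hM.h_comm 1 0] at hcomm
  simp only [riem_vertical, Fin.sum_univ_two]
  linear_combination -hcomm

theorem exists_ric_vertical_eq (hM : M.VerticallyRegularAt u) :
    ∃ K, ∀ a b, M.ric (.inr a) (.inr b) u = K * M.h u a b := by
  let R (a b : Fin 2) : ℝ := ∑ e, M.h u a e * M.riem (.inr e) (.inr b) (.inr 0) (.inr 1) u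
  have hskew (a b : Fin 2) : R a b = -R b a := hM.sum_h_mul_riem_skew a b 0 1
  have hdiag (a : Fin 2) : R a a = 0 := self_eq_neg.mp (hskew a a)
  have hraise (a b : Fin 2) :
      M.riem (.inr a) (.inr b) (.inr 0) (.inr 1) u = ∑ c, (M.h u)⁻¹ a c * R c b :=
    (hM.sum_inv_mul_sum_h_mul (fun e => M.riem (.inr e) (.inr b) (.inr 0) (.inr 1) u) a).symm
  have hinv : (M.h u)⁻¹ = (M.h u).det⁻¹ • !![M.h u 1 1, -M.h u 0 1; -M.h u 1 0, M.h u 0 0] := by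
    rw [Matrix.inv_def, Ring.inverse_eq_inv', Matrix.adjugate_fin_two]
  refine ⟨-((M.h u).det⁻¹ * R 0 1), fun a b => ?_⟩
  rw [ric_vertical, Fin.sum_univ_two]
  fin_cases a <;> fin_cases b <;>
    simp [riem_self, riem_swap _ _ _ 1 0, hraise, hdiag, hskew 1 0, hinv] <;> ring

theorem ric_vertical_eq (hM : M.VerticallyRegularAt u) (a b : Fin 2) :
    M.ric (.inr a) (.inr b) u = M.vGauss u * M.h u a b := by
  obtain ⟨K, hK⟩ := hM.exists_ric_vertical_eq
  have hgauss : M.vGauss u = K := by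
    simp only [vGauss, hK, mul_left_comm _ K, ← Finset.mul_sum, hM.sum_sum_inv_mul_h]
    ring
  rw [hgauss, hK]

end VerticallyRegularAt

/-- The metric with the same horizontal part and N-connection whose vertical part is `ω² h`. -/
noncomputable def conformal (M : DMetric) (ω : Coord → ℝ) : DMetric where
  g := M.g
  h := fun u => ω u ^ 2 • M.h u
  N := M.N

theorem conformal_g (M : DMetric) (ω : Coord → ℝ) : (M.conformal ω).g = M.g :=
  rfl

theorem conformal_h_apply (M : DMetric) (ω : Coord → ℝ) (u : Coord) (a b : Fin 2) :
    (M.conformal ω).h u a b = ω u ^ 2 * M.h u a b :=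
  rfl

theorem conformal_N (M : DMetric) (ω : Coord → ℝ) : (M.conformal ω).N = M.N :=
  rfl

theorem eh_conformal (M : DMetric) (ω f : Coord → ℝ) (i : Fin 3) (u : Coord) :
    (M.conformal ω).eh i f u = M.eh i f u :=
  rfl

namespace VerticallyRegularAt

theorem conformal (hM : M.VerticallyRegularAt u) (hω : ContDiffAt ℝ 2 ω u) (hω0 : ω u ≠ 0) :
    (M.conformal ω).VerticallyRegularAt u where
  isSymm := hM.isSymm.mono fun _ hp => hp.smul _
  isUnit_det := by simpa [DMetric.conformal, hω0] using hM.isUnit_det.ne_zero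
  contDiffAt a b := (hω.pow 2).mul (hM.contDiffAt a b)

theorem conformal_inv_h_apply (hM : M.VerticallyRegularAt u) (hω0 : ω u ≠ 0) (a b : Fin 2) :
    ((M.conformal ω).h u)⁻¹ a b = (ω u ^ 2)⁻¹ * (M.h u)⁻¹ a b := by
  have := invertibleOfNonzero (pow_ne_zero 2 hω0)
  simp only [DMetric.conformal, Matrix.inv_smul _ _ hM.isUnit_det, invOf_eq_inv,
    Matrix.smul_apply, smul_eq_mul]

theorem dy_conformal_h (hM : M.VerticallyRegularAt u) (hω : DifferentiableAt ℝ ω u)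
    (hω0 : ω u ≠ 0) (a b c : Fin 2) :
    dy c (fun p => (M.conformal ω).h p a b) u = ω u ^ 2 *
      (dy c (fun p => M.h p a b) u + 2 * dy c (Real.log ∘ ω) u * M.h u a b) := by
  have hlog : dy c (Real.log ∘ ω) u = (ω u)⁻¹ * dy c ω u := dy_log hω hω0 c
  have hmul := dy_mul (hω.fun_mul hω) (hM.differentiableAt_h a b) c
  simp only [dy_mul hω hω] at hmul
  simp only [conformal_h_apply, pow_two, hmul, hlog]
  field_simp
  ring

theorem Cv_conformal (hM : M.VerticallyRegularAt u) (hω : DifferentiableAt ℝ ω u)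
    (hω0 : ω u ≠ 0) (a b c : Fin 2) :
    (M.conformal ω).Cv a b c u = M.Cv a b c u
      + (1 : Matrix (Fin 2) (Fin 2) ℝ) a b * dy c (Real.log ∘ ω) u
      + (1 : Matrix (Fin 2) (Fin 2) ℝ) a c * dy b (Real.log ∘ ω) u
      - M.h u b c * M.vGrad (Real.log ∘ ω) a u := by
  simp only [Cv, hM.conformal_inv_h_apply hω0, hM.dy_conformal_h hω hω0, vGrad,
    ← hM.sum_inv_mul_h, Finset.mul_sum, Finset.sum_mul, ← Finset.sum_add_distrib,
    ← Finset.sum_sub_distrib]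
  refine Finset.sum_congr rfl fun d _ => ?_
  rw [hM.h_comm b d, hM.h_comm c d]
  field_simp
  ring

theorem CvTrace_conformal (hM : M.VerticallyRegularAt u) (hω : DifferentiableAt ℝ ω u)
    (hω0 : ω u ≠ 0) (a : Fin 2) :
    (M.conformal ω).CvTrace a u = M.CvTrace a u + 2 * dy a (Real.log ∘ ω) u := by
  simp only [CvTrace, hM.Cv_conformal hω hω0, Finset.sum_add_distrib, Finset.sum_sub_distrib,
    hM.sum_h_mul_vGrad]
  simp only [Matrix.one_apply, ite_mul, one_mul, zero_mul, Finset.sum_ite_eq',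
    Finset.mem_univ, if_true, Finset.sum_const, Finset.card_univ, Fintype.card_fin]
  ring

theorem dy_Cv_conformal (hM : M.VerticallyRegularAt u) (hω : ContDiffAt ℝ 2 ω u)
    (hω0 : ω u ≠ 0) (a b c d : Fin 2) :
    dy d ((M.conformal ω).Cv a b c) u = dy d (M.Cv a b c) u
      + (1 : Matrix (Fin 2) (Fin 2) ℝ) a b * dy d (dy c (Real.log ∘ ω)) u
      + (1 : Matrix (Fin 2) (Fin 2) ℝ) a c * dy d (dy b (Real.log ∘ ω)) u
      - (dy d (fun p => M.h p b c) u * M.vGrad (Real.log ∘ ω) a u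
        + M.h u b c * dy d (M.vGrad (Real.log ∘ ω) a) u) := by
  have hlog : ContDiffAt ℝ 2 (Real.log ∘ ω) u := hω.log hω0
  have hφ := differentiableAt_dy hlog
  have hC := hM.differentiableAt_Cv a b c
  have hh := hM.differentiableAt_h b c
  have hgrad := hM.differentiableAt_vGrad hlog a
  rw [dy_congr ((hM.eventually.and (hω.eventually (by simp) |>.and
    (hω.continuousAt.eventually_ne hω0))).mono fun p hp =>
      hp.1.Cv_conformal (hp.2.1.differentiableAt two_ne_zero) hp.2.2 a b c),
    dy_sub ((hC.fun_add ((hφ c).const_mul _)).fun_add ((hφ b).const_mul _)) (hh.fun_mul hgrad),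
    dy_add (hC.fun_add ((hφ c).const_mul _)) ((hφ b).const_mul _),
    dy_add hC ((hφ c).const_mul _), dy_const_mul _ (hφ c), dy_const_mul _ (hφ b), dy_mul hh hgrad]

/- The terms quadratic in `∂ log ω` cancel in dimension two; the linear ones combine with the
second derivatives to the divergence of the gradient of `log ω`. -/
theorem ric_vertical_conformal (hM : M.VerticallyRegularAt u) (hω : ContDiffAt ℝ 2 ω u)
    (hω0 : ω u ≠ 0) (a b : Fin 2) :
    (M.conformal ω).ric (.inr a) (.inr b) u =
      M.ric (.inr a) (.inr b) u - M.vLap (Real.log ∘ ω) u * M.h u a b := by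
  have hlog : ContDiffAt ℝ 2 (Real.log ∘ ω) u := hω.log hω0
  have hcomm := dy_dy_comm hlog 0 1
  simp only [hM.vLap_eq_divergence hlog, ric_vertical, riem_vertical, CvTrace,
    hM.dy_Cv_conformal hω hω0, hM.Cv_conformal (hω.differentiableAt two_ne_zero) hω0,
    hM.dy_dy_eq_sum_vGrad hlog] at hcomm ⊢
  simp only [hM.dy_h, ← hM.sum_h_mul_vGrad (Real.log ∘ ω)] at hcomm ⊢
  simp only [Fin.sum_univ_two, hM.h_comm 1 0, hM.Cv_comm _ 1 0] at hcomm ⊢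
  revert a b
  simp only [Fin.forall_fin_two, Matrix.one_apply, if_true, zero_ne_one, one_ne_zero, if_false,
    hM.h_comm 1 0, hM.Cv_comm _ 1 0]
  refine ⟨⟨?_, ?_⟩, ?_, ?_⟩
  · ring
  · linear_combination hcomm
  · linear_combination -hcomm
  · ring

theorem vGauss_conformal (hM : M.VerticallyRegularAt u) (hω : ContDiffAt ℝ 2 ω u)
    (hω0 : ω u ≠ 0) :
    (M.conformal ω).vGauss u = (ω u ^ 2)⁻¹ * (M.vGauss u - M.vLap (Real.log ∘ ω) u) := by
  have hterm (a b : Fin 2) :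
      ((M.conformal ω).h u)⁻¹ a b * (M.conformal ω).ric (.inr a) (.inr b) u
        = (ω u ^ 2)⁻¹ * ((M.h u)⁻¹ a b * M.ric (.inr a) (.inr b) u
          - M.vLap (Real.log ∘ ω) u * ((M.h u)⁻¹ a b * M.h u a b)) := by
    rw [hM.conformal_inv_h_apply hω0, hM.ric_vertical_conformal hω hω0]
    ring
  simp only [vGauss, hterm, ← Finset.mul_sum, Finset.sum_sub_distrib, hM.sum_sum_inv_mul_h]
  ring

theorem confTerm_eq (hM : M.VerticallyRegularAt u) (hω : ContDiffAt ℝ 2 ω u) (hω0 : ω u ≠ 0) :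
    M.confTerm ω u = (M.conformal ω).vGauss u - M.vGauss u := by
  rw [hM.vGauss_conformal hω hω0]
  rfl

end VerticallyRegularAt

theorem ricMixed_inl (M : DMetric) (i : Fin 3) (β : Idx) (u : Coord) :
    M.ricMixed (.inl i) β u = ∑ j, (M.g u)⁻¹ i j * M.ric (.inl j) β u := by
  simp [ricMixed, metInv]

theorem ricMixed_inr (M : DMetric) (a : Fin 2) (β : Idx) (u : Coord) :
    M.ricMixed (.inr a) β u = ∑ b, (M.h u)⁻¹ a b * M.ric (.inr b) β u := by
  simp [ricMixed, metInv]

theorem VerticallyRegularAt.ricMixed_vertical (hM : M.VerticallyRegularAt u) (a b : Fin 2) :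
    M.ricMixed (.inr a) (.inr b) u = if a = b then M.vGauss u else 0 := by
  simp only [ricMixed_inr, hM.ric_vertical_eq, mul_left_comm _ (M.vGauss u), ← Finset.mul_sum,
    hM.sum_inv_mul_h, Matrix.one_apply, mul_ite, mul_one, mul_zero]

theorem VerticallyRegularAt.ricMixed_vertical_conformal (hM : M.VerticallyRegularAt u)
    (hω : ContDiffAt ℝ 2 ω u) (hω0 : ω u ≠ 0) (a b : Fin 2) :
    (M.conformal ω).ricMixed (.inr a) (.inr b) u =
      M.ricMixed (.inr a) (.inr b) u + if a = b then M.confTerm ω u else 0 := by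
  rw [(hM.conformal hω hω0).ricMixed_vertical, hM.ricMixed_vertical, hM.confTerm_eq hω hω0,
    ite_add_ite, add_sub_cancel, add_zero]

theorem e_zero (M : DMetric) (α : Idx) (u : Coord) : M.e α (fun _ => 0) u = 0 := by
  rcases α with i | a <;> simp [e, eh_eq_fderiv, dy]

theorem ric_horizontal_conformal (M : DMetric) (ω : Coord → ℝ) (i : Fin 3) (β : Idx) (u : Coord) :
    (M.conformal ω).ric (.inl i) β u = M.ric (.inl i) β u := by
  rcases β with j | b <;>
  · simp only [ric, riem, Fintype.sum_sum_type, Gam, e_zero, mul_zero, zero_mul,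
      Finset.sum_const_zero, add_zero, sub_zero]
    rfl

theorem ricMixed_horizontal_conformal (M : DMetric) (ω : Coord → ℝ) (i : Fin 3) (β : Idx)
    (u : Coord) : (M.conformal ω).ricMixed (.inl i) β u = M.ricMixed (.inl i) β u := by
  simp only [ricMixed_inl, ric_horizontal_conformal]
  rfl

section Mixed

variable {i : Fin 3}

theorem eh_dy_log (hω : ContDiffAt ℝ 2 ω u) (hω0 : ω u ≠ 0)
    (hN : ∀ b, DifferentiableAt ℝ (fun p => M.N p b i) u) (heω : M.eh i ω =ᶠ[𝓝 u] 0)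
    (a : Fin 2) :
    M.eh i (dy a (Real.log ∘ ω)) u
      = ∑ b, dy a (fun p => M.N p b i) u * dy b (Real.log ∘ ω) u := by
  have hlog : M.eh i (Real.log ∘ ω) =ᶠ[𝓝 u] fun _ => 0 := by
    filter_upwards [heω, hω.eventually (by simp), hω.continuousAt.eventually_ne hω0]
      with p hp hωp hp0
    exact (eh_log (hωp.differentiableAt two_ne_zero) hp0 i).trans (by rw [hp]; simp)
  have hconst : dy a (fun _ => 0) u = 0 := M.e_zero (.inr a) u
  rw [eh_dy_comm (f := Real.log ∘ ω) (hω.log hω0) hN, dy_congr hlog, hconst, zero_add]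

theorem ric_vertical_horizontal (hM : M.VerticallyRegularAt u)
    (hT : ∀ᶠ p in 𝓝 u, ∀ c a, M.torV c i a p = 0) (a : Fin 2) :
    M.ric (.inr a) (.inl i) u = ∑ b, dy b (dy a fun p => M.N p b i) u - M.eh i (M.CvTrace a) u
      + ∑ b, dy a (fun p => M.N p b i) u * M.CvTrace b u := by
  have hL (c a : Fin 2) : M.Lv c a i =ᶠ[𝓝 u] dy a (fun p => M.N p c i) :=
    hT.mono fun p hp => sub_eq_zero.mp (hp c a)
  have hLu (c a : Fin 2) := (hL c a).eq_of_nhds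
  have hdyL (c a b : Fin 2) := dy_congr (hL c a) b
  have htrace : M.eh i (M.CvTrace a) u = M.eh i (M.Cv 0 a 0) u + M.eh i (M.Cv 1 a 1) u := by
    rw [← eh_add (hM.differentiableAt_Cv 0 a 0) (hM.differentiableAt_Cv 1 a 1)]
    exact eh_congr (.of_forall fun p => Fin.sum_univ_two _) i
  simp [ric, riem, Gam, anh, e, eh_const, Fin.sum_univ_two, hLu, hdyL, htrace, CvTrace]
  ring

namespace VerticallyRegularAt

theorem torV_conformal (hM : M.VerticallyRegularAt u) (hω : DifferentiableAt ℝ ω u)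
    (hω0 : ω u ≠ 0) (heω : M.eh i ω u = 0) (c a : Fin 2) :
    (M.conformal ω).torV c i a u = M.torV c i a u := by
  simp only [torV, Lv, hM.conformal_inv_h_apply hω0, conformal_h_apply, conformal_N, eh_conformal,
    eh_sq_mul hω (hM.differentiableAt_h _ _) heω, Fin.sum_univ_two]
  field_simp

/- Passing to `ω² h` adds `2 ∂_a log ω` to the trace `C_a`; the two resulting terms cancel since
`e_i log ω = 0` turns `e_i ∂_a log ω` into the commutator `[e_i, ∂_a] log ω`. -/
theorem ric_vertical_horizontal_conformal (hM : M.VerticallyRegularAt u)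
    (hω : ContDiffAt ℝ 2 ω u) (hω0 : ω u ≠ 0)
    (hN : ∀ b, DifferentiableAt ℝ (fun p => M.N p b i) u) (heω : M.eh i ω =ᶠ[𝓝 u] 0)
    (hT : ∀ᶠ p in 𝓝 u, ∀ c a, M.torV c i a p = 0) (a : Fin 2) :
    (M.conformal ω).ric (.inr a) (.inl i) u = M.ric (.inr a) (.inl i) u := by
  have hregular : ∀ᶠ p in 𝓝 u,
      M.VerticallyRegularAt p ∧ DifferentiableAt ℝ ω p ∧ ω p ≠ 0 := by
    filter_upwards [hM.eventually, hω.eventually (by simp), hω.continuousAt.eventually_ne hω0]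
      with p hp hωp hp0
    exact ⟨hp, hωp.differentiableAt two_ne_zero, hp0⟩
  have htrace (a : Fin 2) : (M.conformal ω).CvTrace a =ᶠ[𝓝 u]
      fun p => M.CvTrace a p + (dy a (Real.log ∘ ω) p + dy a (Real.log ∘ ω) p) :=
    hregular.mono fun p ⟨hp, hωp, hp0⟩ => (hp.CvTrace_conformal hωp hp0 a).trans (by ring)
  have htorsion : ∀ᶠ p in 𝓝 u, ∀ c a, (M.conformal ω).torV c i a p = 0 := by
    filter_upwards [hregular, heω, hT] with p ⟨hp, hωp, hp0⟩ hep hTp c a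
    rw [hp.torV_conformal hωp hp0 hep, hTp]
  have hlog : DifferentiableAt ℝ (dy a (Real.log ∘ ω)) u := differentiableAt_dy (hω.log hω0) a
  rw [DMetric.ric_vertical_horizontal (hM.conformal hω hω0) htorsion,
    DMetric.ric_vertical_horizontal hM hT, eh_conformal, eh_congr (htrace a),
    eh_add (hM.differentiableAt_CvTrace a) (hlog.fun_add hlog), eh_add hlog hlog,
    eh_dy_log hω hω0 hN heω]
  simp only [(htrace _).eq_of_nhds, conformal_N, mul_add, Finset.sum_add_distrib]
  ring

end VerticallyRegularAt

end Mixed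

section Einstein

theorem VerticallyRegularAt.ric_inr_eq_zero (hM : M.VerticallyRegularAt u) {β : Idx}
    (h : ∀ a, M.ricMixed (.inr a) β u = 0) (a : Fin 2) : M.ric (.inr a) β u = 0 := by
  rw [← hM.sum_h_mul_sum_inv_mul (fun b => M.ric (.inr b) β u) a]
  simp only [← ricMixed_inr, h, mul_zero, Finset.sum_const_zero]

theorem VerticallyRegularAt.ricMixed_conformal (hM : M.VerticallyRegularAt u)
    (hω : ContDiffAt ℝ 2 ω u) (hω0 : ω u ≠ 0) (h : ∀ a i, M.ric (.inr a) (.inl i) u = 0)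
    (hconf : ∀ a i, (M.conformal ω).ric (.inr a) (.inl i) u = 0) (α β : Idx) :
    (M.conformal ω).ricMixed α β u =
      M.ricMixed α β u + diagSource (Sum.elim 0 fun _ => M.confTerm ω) α β u := by
  rcases α with i | a
  · simp [ricMixed_horizontal_conformal, diagSource]
  rcases β with j | b
  · simp [ricMixed_inr, h, hconf, diagSource]
  · simp [hM.ricMixed_vertical_conformal hω hω0, diagSource]

theorem scal_eq (M : DMetric) (u : Coord) : M.scal u =
    ∑ i, ∑ j, (M.g u)⁻¹ i j * M.ric (.inl i) (.inl j) u + 2 * M.vGauss u := by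
  simp [scal, metInv, vGauss]

theorem VerticallyRegularAt.scal_conformal (hM : M.VerticallyRegularAt u)
    (hω : ContDiffAt ℝ 2 ω u) (hω0 : ω u ≠ 0) :
    (M.conformal ω).scal u = M.scal u + 2 * M.confTerm ω u := by
  simp only [scal_eq, ric_horizontal_conformal, hM.confTerm_eq hω hω0, conformal_g]
  ring

theorem metInv_mul_met (hg : IsUnit (M.g u).det) (hh : IsUnit (M.h u).det) :
    M.metInv u * M.met u = 1 := by
  rw [metInv, met, Matrix.fromBlocks_multiply, Matrix.nonsing_inv_mul _ hg,
    Matrix.nonsing_inv_mul _ hh]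
  simp

theorem einMixed_eq (hg : IsUnit (M.g u).det) (hh : IsUnit (M.h u).det) (α β : Idx) :
    M.einMixed α β u = M.ricMixed α β u - diagSource (fun _ p => 1 / 2 * M.scal p) α β u := by
  have hinv : ∑ τ, M.metInv u α τ * M.met u τ β = if α = β then 1 else 0 := by
    rw [← Matrix.mul_apply, metInv_mul_met hg hh, Matrix.one_apply]
  have hein (τ : Idx) : M.metInv u α τ * M.ein τ β u = M.metInv u α τ * M.ric τ β u
      - M.metInv u α τ * M.met u τ β * (1 / 2 * M.scal u) := by
    rw [ein]
    ring
  simp only [einMixed, hein, Finset.sum_sub_distrib, ← Finset.sum_mul, hinv, ricMixed, diagSource,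
    ite_mul, one_mul, zero_mul]

theorem VerticallyRegularAt.einMixed_conformal (hM : M.VerticallyRegularAt u)
    (hg : IsUnit (M.g u).det) (hω : ContDiffAt ℝ 2 ω u) (hω0 : ω u ≠ 0)
    (h : ∀ a i, M.ric (.inr a) (.inl i) u = 0)
    (hconf : ∀ a i, (M.conformal ω).ric (.inr a) (.inl i) u = 0) (α β : Idx) :
    (M.conformal ω).einMixed α β u =
      M.einMixed α β u - diagSource (Sum.elim (fun _ => M.confTerm ω) 0) α β u := by
  have hM' := hM.conformal hω hω0
  rw [einMixed_eq hg hM.isUnit_det, einMixed_eq (M := M.conformal ω) hg hM'.isUnit_det,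
    hM.ricMixed_conformal hω hω0 h hconf]
  simp only [diagSource, hM.scal_conformal hω hω0]
  rcases α with i | a <;> split_ifs <;> simp <;> ring

end Einstein

end DMetric

theorem diagSource_add (S T : Idx → Coord → ℝ) (α β : Idx) (u : Coord) :
    diagSource S α β u + diagSource T α β u = diagSource (S + T) α β u := by
  simp only [diagSource, ite_add_ite, add_zero, Pi.add_apply]

theorem diagSource_sub (S T : Idx → Coord → ℝ) (α β : Idx) (u : Coord) :
    diagSource S α β u - diagSource T α β u = diagSource (S - T) α β u := by
  simp only [diagSource, ite_sub_ite, sub_zero, Pi.sub_apply]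

theorem sourceEntries_sub (S₂ S₄ Z : Coord → ℝ) :
    sourceEntries S₂ S₄ - Sum.elim (fun _ => Z) 0 = sourceEntries (fun p => S₂ p - Z p) S₄ := by
  ext (i | a) u
  · by_cases hi : i = 0 <;> simp [sourceEntries, hi, add_sub_right_comm]
  · simp [sourceEntries]

theorem lemma1_general (U : Set Coord) (hU : IsOpen U) (M : DMetric)
    (hg : ∀ u ∈ U, IsUnit (M.g u).det) (hM : ∀ u ∈ U, M.VerticallyRegularAt u)
    (hN : ∀ a i, DifferentiableOn ℝ (fun u => M.N u a i) U)
    (S : Idx → Coord → ℝ) (hsol : ∀ u ∈ U, ∀ α β : Idx, M.ricMixed α β u = diagSource S α β u)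
    (ω : Coord → ℝ) (hω : ContDiffOn ℝ 2 ω U) (hω0 : ∀ u ∈ U, ω u ≠ 0)
    (heω : ∀ u ∈ U, ∀ k : Fin 3, M.eh k ω u = 0)
    (hT : ∀ u ∈ U, ∀ (c : Fin 2) (j : Fin 3) (a : Fin 2), M.torV c j a u = 0) :
    (∀ u ∈ U, ∀ a b : Fin 2, (M.conformal ω).ricMixed (.inr a) (.inr b) u =
      M.ricMixed (.inr a) (.inr b) u + (if a = b then M.confTerm ω u else 0)) ∧
    (∀ u ∈ U, ∀ (a : Fin 2) (i : Fin 3),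
      (M.conformal ω).ric (.inr a) (.inl i) u = M.ric (.inr a) (.inl i) u ∧
      M.ric (.inr a) (.inl i) u = 0) ∧
    (∀ u ∈ U, ∀ (i : Fin 3) (β : Idx),
      (M.conformal ω).ric (.inl i) β u = M.ric (.inl i) β u) ∧
    (∀ u ∈ U, ∀ α β : Idx, (M.conformal ω).ricMixed α β u =
      diagSource (Sum.elim (fun i => S (.inl i))
        (fun a p => S (.inr a) p + M.confTerm ω p)) α β u) ∧
    (∀ S₂ S₄ : Coord → ℝ,
      (∀ u ∈ U, ∀ α β : Idx, M.einMixed α β u = diagSource (sourceEntries S₂ S₄) α β u) →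
      ∀ u ∈ U, ∀ α β : Idx, (M.conformal ω).einMixed α β u =
        diagSource (sourceEntries (fun p => S₂ p - M.confTerm ω p) S₄) α β u) := by
  have hωU (u) (hu : u ∈ U) : ContDiffAt ℝ 2 ω u := hω.contDiffAt (hU.mem_nhds hu)
  have hric (u) (hu : u ∈ U) (a i) : M.ric (.inr a) (.inl i) u = 0 :=
    (hM u hu).ric_inr_eq_zero (fun b => by simp [hsol u hu, diagSource]) a
  have hconf (u) (hu : u ∈ U) (a i) :
      (M.conformal ω).ric (.inr a) (.inl i) u = M.ric (.inr a) (.inl i) u := by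
    have hU' := hU.mem_nhds hu
    exact (hM u hu).ric_vertical_horizontal_conformal (hωU u hu) (hω0 u hu)
      (fun b => (hN b i).differentiableAt hU') (mem_of_superset hU' fun p hp => heω p hp i)
      (mem_of_superset hU' fun p hp c b => hT p hp c i b) a
  have hconf0 (u) (hu : u ∈ U) (a i) : (M.conformal ω).ric (.inr a) (.inl i) u = 0 :=
    (hconf u hu a i).trans (hric u hu a i)
  refine ⟨fun u hu => (hM u hu).ricMixed_vertical_conformal (hωU u hu) (hω0 u hu),
    fun u hu a i => ⟨hconf u hu a i, hric u hu a i⟩,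
    fun u _ i β => M.ric_horizontal_conformal ω i β u, fun u hu α β => ?_,
    fun S₂ S₄ hein u hu α β => ?_⟩
  · rw [(hM u hu).ricMixed_conformal (hωU u hu) (hω0 u hu) (hric u hu) (hconf0 u hu),
      hsol u hu, diagSource_add]
    congr 1
    ext (i | a) p <;> simp
  · rw [(hM u hu).einMixed_conformal (hg u hu) (hωU u hu) (hω0 u hu) (hric u hu) (hconf0 u hu),
      hein u hu, diagSource_sub, sourceEntries_sub]

namespace Ansatz

variable {A : Ansatz} {U : Set Coord} {ω : Coord → ℝ} {u : Coord}

theorem conformal_toDMetric_one (A : Ansatz) (ω : Coord → ℝ) :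
    (A.toDMetric fun _ => 1).conformal ω = A.toDMetric ω := by
  simp [DMetric.conformal, toDMetric, ← Matrix.diagonal_smul]

namespace RegularOn

theorem isUnit_det_g (hA : A.RegularOn U) (hu : u ∈ U) : IsUnit ((A.toDMetric ω).g u).det := by
  have hε₁ : A.ε₁ ≠ 0 := by rcases hA.eps with h | h <;> simp [h]
  simp [toDMetric, Fin.prod_univ_three, hε₁, hA.g₂_ne u hu, hA.g₃_ne u hu]

theorem differentiableOn_N (hA : A.RegularOn U) (a : Fin 2) (i : Fin 3) :
    DifferentiableOn ℝ (fun u => (A.toDMetric ω).N u a i) U := by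
  fin_cases a
  exacts [(hA.w_smooth i).differentiableOn two_ne_zero,
    (hA.n_smooth i).differentiableOn two_ne_zero]

theorem verticallyRegularAt (hA : A.RegularOn U) (hU : IsOpen U) (hω : ContDiffOn ℝ 2 ω U)
    (hu : u ∈ U) (hω0 : ω u ≠ 0) : (A.toDMetric ω).VerticallyRegularAt u where
  isSymm := .of_forall fun _ => Matrix.isSymm_diagonal _
  isUnit_det := by simp [toDMetric, hω0, hA.h₄_ne u hu, hA.h₅_ne u hu]
  contDiffAt a b := by
    have hU' := hU.mem_nhds hu
    fin_cases a <;> fin_cases b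
    exacts [(((hω.pow 2).mul hA.h₄_smooth).contDiffAt hU'), contDiffAt_const, contDiffAt_const,
      (((hω.pow 2).mul hA.h₅_smooth).contDiffAt hU')]

end RegularOn

end Ansatz

theorem lemma1 (U : Set Coord) (hU : IsOpen U) (A : Ansatz) (hA : A.RegularOn U)
    -- for `ω = 1` the ansatz solves the field equations with a diagonal source
    (S : Idx → Coord → ℝ)
    (hsol : ∀ u ∈ U, ∀ α β : Idx,
      (A.toDMetric (fun _ => 1)).ricMixed α β u = diagSource S α β u)
    -- the vertical factor
    (ω : Coord → ℝ) (hω : ContDiffOn ℝ 2 ω U) (hω0 : ∀ u ∈ U, ω u ≠ 0)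
    (heω : ∀ u ∈ U, ∀ k : Fin 3, (A.toDMetric (fun _ => 1)).eh k ω u = 0)
    (hT : ∀ u ∈ U, ∀ (c : Fin 2) (j : Fin 3) (a : Fin 2),
      (A.toDMetric (fun _ => 1)).torV c j a u = 0) :
    -- the vertical Ricci components change by a diagonal two-dimensional conformal term
    (∀ u ∈ U, ∀ a b : Fin 2,
      (A.toDMetric ω).ricMixed (.inr a) (.inr b) u =
        (A.toDMetric (fun _ => 1)).ricMixed (.inr a) (.inr b) u
          + (if a = b then (A.toDMetric (fun _ => 1)).confTerm ω u else 0)) ∧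
    -- the mixed components `R_ai` stay zero
    (∀ u ∈ U, ∀ (a : Fin 2) (i : Fin 3),
      (A.toDMetric ω).ric (.inr a) (.inl i) u =
        (A.toDMetric (fun _ => 1)).ric (.inr a) (.inl i) u ∧
      (A.toDMetric (fun _ => 1)).ric (.inr a) (.inl i) u = 0) ∧
    -- the components `R_ij` and `R_ia` do not change
    (∀ u ∈ U, ∀ (i : Fin 3) (β : Idx),
      (A.toDMetric ω).ric (.inl i) β u =
        (A.toDMetric (fun _ => 1)).ric (.inl i) β u) ∧
    -- the field equations hold with the redefined source
    (∀ u ∈ U, ∀ α β : Idx,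
      (A.toDMetric ω).ricMixed α β u =
        diagSource
          (Sum.elim (fun i => S (.inl i))
            (fun a p => S (.inr a) p + (A.toDMetric (fun _ => 1)).confTerm ω p)) α β u) ∧
    -- the same in terms of the Einstein tensor, for sources `diag[S₂ + S₄, S₂, S₂, S₄, S₄]`
    (∀ S₂ S₄ : Coord → ℝ,
      (∀ u ∈ U, ∀ α β : Idx,
        (A.toDMetric (fun _ => 1)).einMixed α β u =
          diagSource (sourceEntries S₂ S₄) α β u) →
      ∀ u ∈ U, ∀ α β : Idx,
        (A.toDMetric ω).einMixed α β u =
          diagSource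
            (sourceEntries
              (fun p => S₂ p - (A.toDMetric (fun _ => 1)).confTerm ω p) S₄) α β u) := by
  have h := lemma1_general U hU (A.toDMetric fun _ => 1) (fun u hu => hA.isUnit_det_g hu)
    (fun u hu => hA.verticallyRegularAt hU contDiffOn_const hu one_ne_zero) hA.differentiableOn_N
    S hsol ω hω hω0 heω hT
  rwa [A.conformal_toDMetric_one] at h
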